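/- Write $\mathbb R_+=[0,\infty)$ and $\overline{\mathbb R}_+=[0,\infty]$, both with the Scott topology. For a topological space $X$, a continuous valuation on $X$ is a map $\mu$ from the open subsets of $X$ to $\overline{\mathbb R}_+$ that is strict ($\mu(\emptyset)=0$), monotone, modular ($\mu(U)+\mu(V)=\mu(U\cup V)+\mu(U\cap V)$) and satisfies $\mu(\bigcup_i U_i)=\sup_i\mu(U_i)$ for every directed family $(U_i)_i$. $\mathcal V_wX$ is the set of continuous valuations on $X$ with the weak topology, generated by the sets $[U>r]=\{\mu\mid\mu(U)>r\}$ ($U$ open, $r\in\mathbb R_+$). For lower semicontinuous $h\colon X\to\overline{\mathbb R}_+$ put $\int h\,d\mu=\int_0^\infty\mu(h^{-1}((r,\infty]))\,dr$. On the category $\mathbf{TOP}_0$ of $T_0$ spaces and continuous maps, $\mathcal V_w$ is a monad with $\mathcal V_wf(\mu)(V)=\mu(f^{-1}(V))$, unit $x\mapsto\delta_x$ (Dirac mass) and multiplication $m_X(\varpi)(U)=\int\mu(U)\,d\varpi(\mu)$. A cone is a commutative monoid $C$ with a scalar multiplication by $\mathbb R_+$ satisfying the usual module axioms. It is a semitopological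 (resp. topological) cone if it carries a $T_0$ topology making $+\colon C\times C\to C$ and $\cdot\colon\mathbb R_+\times C\to C$ separately (resp. jointly) continuous. It is weakly locally convex if every open neighbourhood of every point contains a convex (not necessarily open) neighbourhood of that point. A barycentre of a continuous valuation $\nu$ on $C$ is a point $b\in C$ such that $\Lambda(b)=\int\Lambda\,d\nu$ for every lower semicontinuous linear map $\Lambda\colon C\to\overline{\mathbb R}_+$. **Proposition.** Let $C$ be a semitopological cone and $\alpha\colon\mathcal V_wC\to C$ a continuous map such that, for every $\nu\in\mathcal V_wC$, $\alpha(\nu)$ is the unique barycentre of $\nu$. Then: 1. $(C,\alpha)$ is an (Eilenberg–Moore) algebra of the monad $\mathcal V_w$ on $\mathbf{TOP}_0$; 2. the cone structure induced by this algebra is the original one: $\alpha(\delta_x+\delta_y)=x+y$ and $\alpha(r\delta_x)=r\cdot x$ for all $x,y\in C$ and $r\in\mathbb R_+$; 3. $C$ is a sober, weakly locally convex, topological cone. -/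

import Mathlib

open scoped NNReal ENNReal
open TopologicalSpace MeasureTheory Set

universe u

/-- A continuous valuation on a topological space. -/
@[ext]
structure ContinuousValuation (X : Type u) [TopologicalSpace X] where
  toFun : Opens X → ℝ≥0∞
  map_bot' : toFun ⊥ = 0
  mono' : ∀ U V : Opens X, U ≤ V → toFun U ≤ toFun V
  modular' : ∀ U V : Opens X, toFun U + toFun V = toFun (U ⊔ V) + toFun (U ⊓ V)
  map_sSup' : ∀ S : Set (Opens X), S.Nonempty → DirectedOn (· ≤ ·) S →
    toFun (sSup S) = ⨆ U ∈ S, toFun U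

/-- Lower semicontinuous functions from `X` to `[0, ∞]`, that is, functions that are continuous
for the Scott topology on `[0, ∞]`. -/
structure LSC (X : Type u) [TopologicalSpace X] where
  toFun : X → ℝ≥0∞
  lsc : LowerSemicontinuous toFun

namespace LSC

variable {X Y : Type u} [TopologicalSpace X] [TopologicalSpace Y]

instance : CoeFun (LSC X) (fun _ => X → ℝ≥0∞) := ⟨LSC.toFun⟩

theorem ext_fun {f g : LSC X} (h : ∀ x, f x = g x) : f = g := by
  cases f; cases g; congr; funext x; exact h x

/-- The open set `h⁻¹ (r, ∞]`. -/
def level (h : LSC X) (r : ℝ≥0∞) : Opens X := ⟨h ⁻¹' Ioi r, h.lsc.isOpen_preimage r⟩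

theorem mem_level {h : LSC X} {r : ℝ≥0∞} {x : X} : x ∈ h.level r ↔ r < h x := Iff.rfl

/-- Composition of a lower semicontinuous function with a continuous map. -/
def comp (h : LSC Y) (f : C(X, Y)) : LSC X := ⟨h ∘ f, h.lsc.comp f.continuous⟩

/-- The pointwise sum. -/
noncomputable def add (f g : LSC X) : LSC X := ⟨fun x => f x + g x, f.lsc.add g.lsc⟩

/-- The pointwise scalar multiple. -/
noncomputable def smul (c : ℝ≥0) (f : LSC X) : LSC X :=
  ⟨fun x => c * f x, (ENNReal.continuous_const_mul ENNReal.coe_ne_top).comp_lowerSemicontinuous f.lsc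
    fun _ _ h => mul_le_mul_right h _⟩

/-- The function `c · χ_U`. -/
noncomputable def step (c : ℝ≥0) (U : Opens X) : LSC X :=
  ⟨indicator (U : Set X) fun _ => (c : ℝ≥0∞), U.isOpen.lowerSemicontinuous_indicator (by simp)⟩

/-- Adding the step functions `c · χ_{U 0}, …, c · χ_{U (n - 1)}` to `f`. -/
noncomputable def addSteps (f : LSC X) (c : ℝ≥0) (U : ℕ → Opens X) : ℕ → LSC X
  | 0 => f
  | n + 1 => (addSteps f c U n).add (step c (U n))

/-- The zero function. -/
noncomputable def zero : LSC X := ⟨fun _ => 0, lowerSemicontinuous_const⟩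

theorem addSteps_apply (f : LSC X) (c : ℝ≥0) (U : ℕ → Opens X) (n : ℕ) (x : X) :
    addSteps f c U n x = f x + ∑ k ∈ Finset.range n, step c (U k) x := by
  induction n with
  | zero => simp [addSteps]
  | succ n ih =>
    rw [Finset.sum_range_succ, ← add_assoc, ← ih]
    rfl

end LSC

namespace ContinuousValuation

variable {X Y : Type u} [TopologicalSpace X] [TopologicalSpace Y]

instance : CoeFun (ContinuousValuation X) (fun _ => Opens X → ℝ≥0∞) :=
  ⟨ContinuousValuation.toFun⟩

theorem ext_apply {μ ν : ContinuousValuation X} (h : ∀ U, μ U = ν U) : μ = ν :=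
  ContinuousValuation.ext (funext h)

theorem mono (μ : ContinuousValuation X) {U V : Opens X} (h : U ≤ V) : μ U ≤ μ V :=
  μ.mono' U V h

theorem map_iSup_directed (μ : ContinuousValuation X) {ι : Type*} [Nonempty ι] (U : ι → Opens X)
    (hU : Directed (· ≤ ·) U) : μ (⨆ i, U i) = ⨆ i, μ (U i) := by
  have h := μ.map_sSup' (range U) (range_nonempty U) (by
    rintro _ ⟨i, rfl⟩ _ ⟨j, rfl⟩
    obtain ⟨k, hik, hjk⟩ := hU i j
    exact ⟨_, mem_range_self k, hik, hjk⟩)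
  rw [sSup_range] at h
  rw [h, iSup_range]

/-- The integral `∫ h dμ = ∫₀^∞ μ (h⁻¹ (r, ∞]) dr`. The integrand is antitone in `r`, so its
Lebesgue integral is its improper Riemann integral. -/
noncomputable def integral (μ : ContinuousValuation X) (h : LSC X) : ℝ≥0∞ :=
  ∫⁻ r in Ioi (0 : ℝ), μ (h.level (ENNReal.ofReal r))

theorem antitone_level (μ : ContinuousValuation X) (h : LSC X) :
    Antitone fun r : ℝ => μ (h.level (ENNReal.ofReal r)) := by
  intro r s hrs
  exact μ.mono fun x hx => lt_of_le_of_lt (ENNReal.ofReal_le_ofReal hrs) hx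

theorem integral_mono (μ : ContinuousValuation X) {f g : LSC X} (h : ∀ x, f x ≤ g x) :
    μ.integral f ≤ μ.integral g :=
  lintegral_mono fun _ => μ.mono fun x hx => lt_of_lt_of_le hx (h x)

theorem integral_iSup_nat (μ : ContinuousValuation X) (f : ℕ → LSC X) (g : LSC X)
    (hf : ∀ x, Monotone fun n => f n x) (hg : ∀ x, g x = ⨆ n, f n x) :
    μ.integral g = ⨆ n, μ.integral (f n) := by
  unfold integral
  rw [← lintegral_iSup]
  · refine lintegral_congr fun r => ?_
    rw [← map_iSup_directed]
    · congr 1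
      ext x
      simp only [SetLike.mem_coe, Opens.mem_iSup, LSC.mem_level, hg, lt_iSup_iff]
    · refine Monotone.directed_le ?_
      intro n m hnm x hx
      exact lt_of_lt_of_le hx (hf x hnm)
  · intro n
    exact (μ.antitone_level (f n)).measurable
  · intro n m hnm r
    exact μ.mono fun x hx => lt_of_lt_of_le hx (hf x hnm)

theorem integral_add_step (μ : ContinuousValuation X) (h : LSC X) (c : ℝ≥0) (U : Opens X) :
    μ.integral (h.add (LSC.step c U)) = μ.integral h + c * μ U := by
  classical
  -- `L s` is the set `{h > s}`, read as everything when `s < 0`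
  let L : ℝ → Opens X := fun s => if s < 0 then ⊤ else h.level (ENNReal.ofReal s)
  have hLanti : Antitone L := by
    intro s t hst
    by_cases hs : s < 0
    · simp [L, hs]
    · have ht : ¬ t < 0 := fun h => hs (lt_of_le_of_lt hst h)
      simp only [L, hs, ht, if_false]
      intro x hx
      exact lt_of_le_of_lt (ENNReal.ofReal_le_ofReal hst) hx
  let H : ℝ → ℝ≥0∞ := fun s => μ (L s ⊓ U)
  have hHanti : Antitone H := fun s t hst => μ.mono (inf_le_inf_right U (hLanti hst))
  have hH : Measurable H := hHanti.measurable
  let J : ℝ≥0∞ := ∫⁻ s in Ioi (0 : ℝ), H s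
  have hshift : ∫⁻ r in Ioi (0 : ℝ), H (r - c) = c * μ U + J := by
    have h1 : ∫⁻ r in Ioi (0 : ℝ), H (r - c) = ∫⁻ s in Ioi (-(c : ℝ)), H s := by
      have := (measurePreserving_sub_right (volume : Measure ℝ) (c : ℝ)).setLIntegral_comp_preimage
        (s := Ioi (-(c : ℝ))) measurableSet_Ioi hH
      rw [← this]
      congr 2
      ext r
      simp
    have h2 : Ioi (-(c : ℝ)) = Ioc (-(c : ℝ)) 0 ∪ Ioi 0 := by
      rw [Ioc_union_Ioi_eq_Ioi]; simp
    rw [h1, h2, lintegral_union measurableSet_Ioi (by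
      rw [Set.disjoint_left]; intro x hx hx'; exact absurd hx.2 (not_le.2 hx'))]
    congr 1
    rw [← setLIntegral_congr (Ioo_ae_eq_Ioc (μ := volume) (a := -(c : ℝ)) (b := 0))]
    have h3 : ∫⁻ s in Ioo (-(c : ℝ)) 0, H s = ∫⁻ s in Ioo (-(c : ℝ)) 0, μ U := by
      refine setLIntegral_congr_fun measurableSet_Ioo fun s hs => ?_
      simp [H, L, hs.2]
    rw [h3, setLIntegral_const, Real.volume_Ioo, mul_comm]
    simp
  have hmod : ∀ r ∈ Ioi (0 : ℝ),
      μ ((h.add (LSC.step c U)).level (ENNReal.ofReal r)) + H r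
        = μ (h.level (ENNReal.ofReal r)) + H (r - c) := by
    intro r hr
    have hr0 : ¬ r < 0 := not_lt.2 (le_of_lt hr)
    have hLr : L r = h.level (ENNReal.ofReal r) := by simp [L, hr0]
    have hle : L r ≤ L (r - c) := hLanti (by simp)
    have hunion : (h.add (LSC.step c U)).level (ENNReal.ofReal r) = L r ⊔ (L (r - c) ⊓ U) := by
      ext x
      have hx1 : x ∈ (h.add (LSC.step c U)).level (ENNReal.ofReal r) ↔
        ENNReal.ofReal r < h x + indicator (U : Set X) (fun _ => (c : ℝ≥0∞)) x := Iff.rfl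
      simp only [SetLike.mem_coe, Opens.coe_sup, Opens.coe_inf, mem_union, mem_inter_iff]
      rw [hx1, hLr, LSC.mem_level]
      by_cases hxU : x ∈ U
      · have hxU' : x ∈ (U : Set X) := hxU
        rw [indicator_of_mem hxU']
        by_cases hrc : r - c < 0
        · have : ENNReal.ofReal r < h x + c := by
            refine lt_of_lt_of_le ?_ le_add_self
            rw [← ENNReal.ofReal_coe_nnreal]
            exact (ENNReal.ofReal_lt_ofReal_iff_of_nonneg (le_of_lt hr)).2 (by linarith)
          simp [L, hrc, hxU, this]
        · have hL : x ∈ L (r - c) ↔ ENNReal.ofReal r < h x + c := by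
            simp only [L, hrc, if_false, LSC.mem_level]
            rw [ENNReal.ofReal_sub _ c.coe_nonneg, ENNReal.ofReal_coe_nnreal]
            have hcr : (c : ℝ≥0∞) ≤ ENNReal.ofReal r := by
              rw [← ENNReal.ofReal_coe_nnreal]
              exact ENNReal.ofReal_le_ofReal (by linarith)
            conv_rhs => rw [← tsub_add_cancel_of_le hcr]
            exact (ENNReal.add_lt_add_iff_right ENNReal.coe_ne_top).symm
          rw [hL]
          constructor
          · intro h'
            exact Or.inr ⟨h', hxU⟩
          · rintro (h' | ⟨h', _⟩)
            · exact lt_of_lt_of_le h' le_self_add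
            · exact h'
      · have hxU' : x ∉ (U : Set X) := hxU
        rw [indicator_of_notMem hxU']
        simp [hxU]
    have hinter : L r ⊓ (L (r - c) ⊓ U) = L r ⊓ U := by
      rw [← inf_assoc, inf_eq_left.2 hle]
    rw [hunion, ← hLr]
    have := μ.modular' (L r) (L (r - c) ⊓ U)
    rw [hinter] at this
    exact this.symm
  have hsum : μ.integral (h.add (LSC.step c U)) + J = μ.integral h + c * μ U + J := by
    have := setLIntegral_congr_fun (μ := volume) (measurableSet_Ioi (a := (0 : ℝ))) hmod
    rw [lintegral_add_right _ hH, lintegral_add_left (μ.antitone_level h).measurable,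
      hshift] at this
    unfold integral
    rw [this, add_assoc]
  have hJ : J ≤ μ.integral h := by
    refine setLIntegral_mono' measurableSet_Ioi fun r hr => ?_
    have hr0 : ¬ r < 0 := not_lt.2 (le_of_lt hr)
    refine μ.mono (inf_le_left.trans ?_)
    simp [L, hr0]
  by_cases hJt : J = ∞
  · have h1 : μ.integral h = ∞ := top_le_iff.1 (hJt ▸ hJ)
    have h2 : μ.integral h ≤ μ.integral (h.add (LSC.step c U)) :=
      μ.integral_mono fun x => le_self_add
    rw [h1, top_add, top_le_iff.1 (h1.symm.le.trans h2)]
  · exact (ENNReal.add_left_inj hJt).1 hsum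

theorem integral_addSteps (μ : ContinuousValuation X) (f : LSC X) (c : ℝ≥0) (U : ℕ → Opens X)
    (n : ℕ) :
    μ.integral (f.addSteps c U n) = μ.integral f + ∑ k ∈ Finset.range n, c * μ (U k) := by
  induction n with
  | zero => simp [LSC.addSteps]
  | succ n ih => rw [LSC.addSteps, integral_add_step, ih, Finset.sum_range_succ, add_assoc]

theorem integral_zero (μ : ContinuousValuation X) : μ.integral LSC.zero = 0 := by
  unfold integral
  have : ∀ r : ℝ, (LSC.zero : LSC X).level (ENNReal.ofReal r) = ⊥ := by
    intro r
    rw [eq_bot_iff]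
    intro x hx
    exact absurd (LSC.mem_level.1 hx) (not_lt_bot (a := ENNReal.ofReal r))
  simp [this, μ.map_bot']

end ContinuousValuation

/-! Approximation of lower semicontinuous functions by step functions. -/

/-- The sum of those `u` for which `(k + 1) u < t`, with `k < n`. -/
noncomputable def stepSum (u : ℝ≥0) (n : ℕ) (t : ℝ≥0∞) : ℝ≥0∞ :=
  ∑ k ∈ Finset.range n, if (((k + 1 : ℕ) * u : ℝ≥0) : ℝ≥0∞) < t then (u : ℝ≥0∞) else 0

theorem stepSum_mono {u : ℝ≥0} {m n : ℕ} (h : m ≤ n) (t : ℝ≥0∞) :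
    stepSum u m t ≤ stepSum u n t :=
  Finset.sum_le_sum_of_subset (Finset.range_mono h)

theorem stepSum_le (u : ℝ≥0) (n : ℕ) (t : ℝ≥0∞) :
    stepSum u n t ≤ ((n * u : ℝ≥0) : ℝ≥0∞) ∧ stepSum u n t ≤ t := by
  induction n with
  | zero => simp [stepSum]
  | succ n ih =>
    have hs : stepSum u (n + 1) t = stepSum u n t +
      if (((n + 1 : ℕ) * u : ℝ≥0) : ℝ≥0∞) < t then (u : ℝ≥0∞) else 0 := Finset.sum_range_succ _ _
    have he : (((n + 1 : ℕ) * u : ℝ≥0) : ℝ≥0∞) = ((n * u : ℝ≥0) : ℝ≥0∞) + u := by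
      push_cast; ring
    rw [hs]
    split_ifs with h
    · have : stepSum u n t + u ≤ (((n + 1 : ℕ) * u : ℝ≥0) : ℝ≥0∞) := by
        rw [he]; gcongr; exact ih.1
      exact ⟨this, this.trans h.le⟩
    · rw [add_zero]
      exact ⟨ih.1.trans (he ▸ le_self_add), ih.2⟩

theorem le_stepSum {u : ℝ≥0} {m n : ℕ} {t : ℝ≥0∞} (hmn : m ≤ n)
    (h : ((m * u : ℝ≥0) : ℝ≥0∞) < t) : ((m * u : ℝ≥0) : ℝ≥0∞) ≤ stepSum u n t := by
  refine le_trans (le_of_eq ?_) (stepSum_mono hmn t)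
  unfold stepSum
  rw [Finset.sum_congr rfl (g := fun _ => (u : ℝ≥0∞))]
  · simp
  · intro k hk
    refine if_pos (lt_of_le_of_lt ?_ h)
    have hk' : k + 1 ≤ m := Finset.mem_range.1 hk
    gcongr

theorem stepSum_double (u : ℝ≥0) (n : ℕ) (t : ℝ≥0∞) :
    stepSum u n t ≤ stepSum (u / 2) (2 * n) t := by
  induction n with
  | zero => simp [stepSum]
  | succ n ih =>
    have e : 2 * (n + 1) = 2 * n + 1 + 1 := by ring
    have h1 : ((n + 1 : ℕ) * u : ℝ≥0) = ((2 * n + 1 + 1 : ℕ) * (u / 2) : ℝ≥0) := by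
      push_cast; field_simp; ring
    have h2 : ((2 * n + 1 : ℕ) * (u / 2) : ℝ≥0) ≤ ((2 * n + 1 + 1 : ℕ) * (u / 2) : ℝ≥0) := by
      gcongr; omega
    unfold stepSum at ih ⊢
    rw [e, Finset.sum_range_succ, Finset.sum_range_succ, Finset.sum_range_succ, add_assoc]
    refine add_le_add ih ?_
    rw [h1]
    split_ifs with ha hb
    · rw [← ENNReal.coe_add, add_halves]
    · exact absurd (lt_of_le_of_lt (ENNReal.coe_le_coe.2 h2) ha) hb
    · exact zero_le
    · exact zero_le

theorem stepSum_monotone (t : ℝ≥0∞) : Monotone fun N : ℕ => stepSum ((1 / 2) ^ N) (4 ^ N) t := by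
  refine monotone_nat_of_le_succ fun N => (stepSum_double _ _ t).trans ?_
  have : ((1 / 2 : ℝ≥0)) ^ N / 2 = (1 / 2) ^ (N + 1) := by rw [pow_succ]; ring
  rw [this]
  refine stepSum_mono ?_ t
  rw [pow_succ]
  have := Nat.zero_le (4 ^ N)
  omega

theorem iSup_stepSum (t : ℝ≥0∞) : ⨆ N : ℕ, stepSum ((1 / 2) ^ N) (4 ^ N) t = t := by
  refine le_antisymm (iSup_le fun N => (stepSum_le _ _ t).2) ?_
  refine ENNReal.le_of_forall_nnreal_lt fun r hr => ?_
  obtain ⟨s, hrs, hst⟩ := ENNReal.lt_iff_exists_nnreal_btwn.1 hr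
  have hrs' : r < s := ENNReal.coe_lt_coe.1 hrs
  obtain ⟨N₁, hN₁⟩ := exists_pow_lt_of_lt_one (tsub_pos_of_lt hrs') (by norm_num : (1 / 2 : ℝ≥0) < 1)
  obtain ⟨N₂, hN₂⟩ := pow_unbounded_of_one_lt (r + 1) (by norm_num : (1 : ℝ≥0) < 2)
  let N := max N₁ N₂
  have hu : ((1 / 2 : ℝ≥0)) ^ N < s - r :=
    lt_of_le_of_lt (pow_le_pow_of_le_one zero_le (by norm_num) (le_max_left _ _)) hN₁
  have hw : r + 1 ≤ (2 : ℝ≥0) ^ N := hN₂.le.trans (pow_le_pow_right₀ (by norm_num) (le_max_right _ _))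
  have hinv : (2 : ℝ≥0) ^ N * (1 / 2) ^ N = 1 := by rw [← mul_pow]; norm_num
  let m := ⌊r * 2 ^ N⌋₊ + 1
  have hm1 : (m : ℝ≥0) ≤ r * 2 ^ N + 1 := by
    simp only [m]; push_cast; gcongr; exact Nat.floor_le zero_le
  have hm2 : r * 2 ^ N ≤ m := by
    simp only [m]; push_cast; exact (Nat.lt_floor_add_one _).le
  have hm4 : m ≤ 4 ^ N := by
    have : (m : ℝ≥0) ≤ ((4 ^ N : ℕ) : ℝ≥0) := by
      have h4 : ((4 ^ N : ℕ) : ℝ≥0) = 2 ^ N * 2 ^ N := by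
        push_cast; rw [← mul_pow]; norm_num
      rw [h4]
      calc (m : ℝ≥0) ≤ r * 2 ^ N + 1 := hm1
        _ ≤ r * 2 ^ N + 1 * 2 ^ N := by
          gcongr; rw [one_mul]; exact one_le_pow₀ (by norm_num)
        _ = (r + 1) * 2 ^ N := by ring
        _ ≤ 2 ^ N * 2 ^ N := by gcongr
    exact_mod_cast this
  have hlow : r ≤ m * (1 / 2) ^ N := by
    calc r = r * 2 ^ N * (1 / 2) ^ N := by rw [mul_assoc, hinv, mul_one]
      _ ≤ m * (1 / 2) ^ N := by gcongr
  have hup : (m : ℝ≥0) * (1 / 2) ^ N < s := by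
    calc (m : ℝ≥0) * (1 / 2) ^ N ≤ (r * 2 ^ N + 1) * (1 / 2) ^ N := by gcongr
      _ = r + (1 / 2) ^ N := by rw [add_mul, mul_assoc, hinv, mul_one, one_mul]
      _ < r + (s - r) := by gcongr
      _ = s := add_tsub_cancel_of_le hrs'.le
  refine le_iSup_of_le N (le_trans (ENNReal.coe_le_coe.2 hlow) (le_stepSum hm4 ?_))
  exact lt_trans (ENNReal.coe_lt_coe.2 hup) hst

namespace LSC

variable {X Y : Type u} [TopologicalSpace X] [TopologicalSpace Y]

/-- The `k`-th level set at mesh `2⁻ᴺ`. -/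
noncomputable def dyadicLevel (h : LSC X) (N k : ℕ) : Opens X :=
  h.level (((k + 1 : ℕ) * (1 / 2) ^ N : ℝ≥0) : ℝ≥0∞)

theorem addSteps_dyadic (f h : LSC X) (N : ℕ) (x : X) :
    f.addSteps ((1 / 2) ^ N) (h.dyadicLevel N) (4 ^ N) x
      = f x + stepSum ((1 / 2) ^ N) (4 ^ N) (h x) := by
  classical
  rw [addSteps_apply]
  congr 1
  refine Finset.sum_congr rfl fun k _ => ?_
  exact (Set.indicator_apply (h.dyadicLevel N k : Set X) (fun _ => (((1 / 2) ^ N : ℝ≥0) : ℝ≥0∞)) x).trans (if_congr Iff.rfl rfl rfl)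

end LSC

namespace ContinuousValuation

variable {X Y : Type u} [TopologicalSpace X] [TopologicalSpace Y]

/-- The lower dyadic sums of the integral. -/
noncomputable def dyadicSum (μ : ContinuousValuation X) (h : LSC X) (N : ℕ) : ℝ≥0∞ :=
  ∑ k ∈ Finset.range (4 ^ N), (((1 / 2) ^ N : ℝ≥0) : ℝ≥0∞) * μ (h.dyadicLevel N k)

theorem integral_add_eq_iSup (μ : ContinuousValuation X) (f h : LSC X) :
    μ.integral (f.add h) = ⨆ N, (μ.integral f + μ.dyadicSum h N) := by
  rw [μ.integral_iSup_nat (fun N => f.addSteps ((1 / 2) ^ N) (h.dyadicLevel N) (4 ^ N))]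
  · exact iSup_congr fun N => μ.integral_addSteps _ _ _ _
  · intro x N M hNM
    simp only [LSC.addSteps_dyadic]
    gcongr
    exact stepSum_monotone (h x) hNM
  · intro x
    simp only [LSC.addSteps_dyadic]
    rw [← ENNReal.add_iSup, iSup_stepSum]
    rfl

theorem dyadicSum_monotone (μ : ContinuousValuation X) (h : LSC X) :
    Monotone (μ.dyadicSum h) := by
  intro N M hNM
  have e : ∀ N, μ.dyadicSum h N
      = μ.integral (LSC.zero.addSteps ((1 / 2) ^ N) (h.dyadicLevel N) (4 ^ N)) := fun N => by
    rw [integral_addSteps, integral_zero, zero_add]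
    rfl
  rw [e, e]
  refine μ.integral_mono fun x => ?_
  rw [LSC.addSteps_dyadic, LSC.addSteps_dyadic]
  gcongr
  exact stepSum_monotone (h x) hNM

theorem integral_eq_iSup (μ : ContinuousValuation X) (h : LSC X) :
    μ.integral h = ⨆ N, μ.dyadicSum h N := by
  have : h = LSC.zero.add h := LSC.ext_fun fun x => (zero_add (h x)).symm
  conv_lhs => rw [this]
  rw [integral_add_eq_iSup]
  simp [integral_zero]

theorem integral_add (μ : ContinuousValuation X) (f h : LSC X) :
    μ.integral (f.add h) = μ.integral f + μ.integral h := by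
  rw [integral_add_eq_iSup, ← ENNReal.add_iSup, ← integral_eq_iSup]

theorem integral_smul_half_pow (μ : ContinuousValuation X) (N : ℕ) (f : LSC X) :
    μ.integral (f.smul ((1 / 2) ^ N)) = (((1 / 2) ^ N : ℝ≥0) : ℝ≥0∞) * μ.integral f := by
  induction N with
  | zero =>
    have : f.smul ((1 / 2) ^ 0) = f := LSC.ext_fun fun x => by simp [LSC.smul]
    rw [this]
    simp
  | succ N ih =>
    have hc : (((1 / 2) ^ N : ℝ≥0) : ℝ≥0∞)
        = (((1 / 2) ^ (N + 1) : ℝ≥0) : ℝ≥0∞) + (((1 / 2) ^ (N + 1) : ℝ≥0) : ℝ≥0∞) := by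
      rw [← ENNReal.coe_add, pow_succ, ← mul_add]
      norm_num
    have hf : f.smul ((1 / 2) ^ N) = (f.smul ((1 / 2) ^ (N + 1))).add (f.smul ((1 / 2) ^ (N + 1))) :=
      LSC.ext_fun fun x => by
        change _ * f x = _ * f x + _ * f x
        rw [hc, add_mul]
    rw [hf, integral_add, hc, add_mul, ← two_mul, ← two_mul] at ih
    exact (ENNReal.mul_right_inj (by simp) (by simp)).1 ih

theorem integral_iSup_directed (μ : ContinuousValuation X) {ι : Type*} [Nonempty ι]
    (f : ι → LSC X) (g : LSC X) (hf : Directed (fun a b : LSC X => ∀ x, a x ≤ b x) f)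
    (hg : ∀ x, g x = ⨆ i, f i x) : μ.integral g = ⨆ i, μ.integral (f i) := by
  have hlev : ∀ N k, μ (g.dyadicLevel N k) = ⨆ i, μ ((f i).dyadicLevel N k) := by
    intro N k
    rw [← map_iSup_directed]
    · congr 1
      ext x
      simp only [SetLike.mem_coe, Opens.mem_iSup, LSC.dyadicLevel, LSC.mem_level, hg, lt_iSup_iff]
    · intro i j
      obtain ⟨l, hil, hjl⟩ := hf i j
      exact ⟨l, fun x hx => lt_of_lt_of_le hx (hil x), fun x hx => lt_of_lt_of_le hx (hjl x)⟩
  rw [integral_eq_iSup]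
  simp_rw [integral_eq_iSup]
  rw [iSup_comm]
  refine iSup_congr fun N => ?_
  unfold dyadicSum
  simp_rw [hlev, ENNReal.mul_iSup]
  refine ENNReal.finsetSum_iSup fun i j => ?_
  obtain ⟨l, hil, hjl⟩ := hf i j
  refine ⟨l, fun k => ⟨?_, ?_⟩⟩
  · gcongr
    exact μ.mono fun x hx => lt_of_lt_of_le hx (hil x)
  · gcongr
    exact μ.mono fun x hx => lt_of_lt_of_le hx (hjl x)

end ContinuousValuation

namespace ContinuousValuation

variable {X Y : Type u} [TopologicalSpace X] [TopologicalSpace Y]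

/-- The weak topology, generated by the sets `[U > r] = {μ | μ U > r}`. -/
instance weakTopology : TopologicalSpace (ContinuousValuation X) :=
  generateFrom {S | ∃ (U : Opens X) (r : ℝ≥0), S = {μ | (r : ℝ≥0∞) < μ U}}

theorem isOpen_setOf_lt (U : Opens X) (r : ℝ≥0) :
    IsOpen {μ : ContinuousValuation X | (r : ℝ≥0∞) < μ U} :=
  isOpen_generateFrom_of_mem ⟨U, r, rfl⟩

/-- The lower semicontinuous function `μ ↦ μ U`. -/
def eval (U : Opens X) : LSC (ContinuousValuation X) where
  toFun μ := μ U
  lsc := by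
    rw [lowerSemicontinuous_iff_isOpen_preimage]
    intro r
    induction r with
    | top => simp
    | coe r => exact isOpen_setOf_lt U r

/-- The lower semicontinuous function `μ ↦ ∫ h dμ`. -/
noncomputable def evalIntegral (h : LSC X) : LSC (ContinuousValuation X) where
  toFun μ := μ.integral h
  lsc := by
    simp_rw [integral_eq_iSup]
    exact lowerSemicontinuous_iSup fun N => lowerSemicontinuous_sum fun k _ =>
      ((eval (h.dyadicLevel N k)).smul ((1 / 2) ^ N)).lsc

instance : T0Space (ContinuousValuation X) := by
  refine ⟨fun μ ν h => ext_apply fun U => ?_⟩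
  have key : ∀ r : ℝ≥0, (r : ℝ≥0∞) < μ U ↔ (r : ℝ≥0∞) < ν U := fun r =>
    h.mem_open_iff (isOpen_setOf_lt U r)
  exact le_antisymm (ENNReal.le_of_forall_nnreal_lt fun r hr => ((key r).1 hr).le)
    (ENNReal.le_of_forall_nnreal_lt fun r hr => ((key r).2 hr).le)

/-- The Dirac mass `δ_x`. -/
noncomputable def dirac (x : X) : ContinuousValuation X where
  toFun U := indicator (U : Set X) (fun _ => 1) x
  map_bot' := by simp
  mono' U V h := indicator_le_indicator_of_subset h (fun _ => zero_le) x
  modular' U V := by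
    classical
    by_cases hU : x ∈ U <;> by_cases hV : x ∈ V <;> simp [hU, hV]
  map_sSup' S _ _ := by
    classical
    by_cases h : x ∈ sSup S
    · obtain ⟨U, hU, hx⟩ := Opens.mem_sSup.1 h
      rw [indicator_of_mem (show x ∈ ((sSup S : Opens X) : Set X) from h)]
      refine le_antisymm ?_ (iSup₂_le fun V _ => indicator_apply_le fun _ => le_rfl)
      refine le_iSup₂_of_le U hU ?_
      rw [indicator_of_mem (show x ∈ (U : Set X) from hx)]
    · rw [indicator_of_notMem (show x ∉ ((sSup S : Opens X) : Set X) from h)]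
      refine (le_antisymm (iSup₂_le fun V hV => ?_) zero_le).symm
      rw [indicator_of_notMem]
      exact fun hx => h (Opens.mem_sSup.2 ⟨V, hV, hx⟩)

/-- The sum of two continuous valuations. -/
noncomputable instance : Add (ContinuousValuation X) where
  add μ ν :=
    { toFun := fun U => μ U + ν U
      map_bot' := by simp [map_bot']
      mono' := fun U V h => add_le_add (μ.mono h) (ν.mono h)
      modular' := fun U V => by
        rw [add_add_add_comm, μ.modular', ν.modular', add_add_add_comm]
      map_sSup' := fun S hS hd => by
        have : Nonempty S := hS.to_subtype
        rw [μ.map_sSup' S hS hd, ν.map_sSup' S hS hd, iSup_subtype', iSup_subtype', iSup_subtype']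
        refine ENNReal.iSup_add_iSup fun i j => ?_
        obtain ⟨k, hk, hik, hjk⟩ := hd i i.2 j j.2
        exact ⟨⟨k, hk⟩, add_le_add (μ.mono hik) (ν.mono hjk)⟩ }

/-- Multiplication of a continuous valuation by a nonnegative real number. -/
noncomputable instance : SMul ℝ≥0 (ContinuousValuation X) where
  smul r μ :=
    { toFun := fun U => r * μ U
      map_bot' := by simp [map_bot']
      mono' := fun U V h => by gcongr; exact μ.mono h
      modular' := fun U V => by rw [← mul_add, μ.modular', mul_add]
      map_sSup' := fun S hS hd => by
        rw [μ.map_sSup' S hS hd]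
        simp_rw [ENNReal.mul_iSup] }

theorem add_apply (μ ν : ContinuousValuation X) (U : Opens X) : (μ + ν) U = μ U + ν U := rfl

theorem smul_apply (r : ℝ≥0) (μ : ContinuousValuation X) (U : Opens X) :
    (r • μ) U = r * μ U := rfl

/-- The image valuation `V ↦ μ (f⁻¹ V)`. -/
def map (f : C(X, Y)) (μ : ContinuousValuation X) : ContinuousValuation Y where
  toFun V := μ (Opens.comap f V)
  map_bot' := μ.map_bot'
  mono' U V h := μ.mono (Opens.comap_mono f h)
  modular' U V := μ.modular' _ _
  map_sSup' S hS hd := by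
    have : Nonempty S := hS.to_subtype
    rw [sSup_eq_iSup', map_iSup, map_iSup_directed, iSup_subtype']
    intro i j
    obtain ⟨k, hk, hik, hjk⟩ := hd i i.2 j j.2
    exact ⟨⟨k, hk⟩, Opens.comap_mono f hik, Opens.comap_mono f hjk⟩

/-- The multiplication of the monad: `join ϖ U = ∫ μ U dϖ(μ)`. -/
noncomputable def join (ϖ : ContinuousValuation (ContinuousValuation X)) :
    ContinuousValuation X where
  toFun U := ϖ.integral (eval U)
  map_bot' := by
    rw [show (eval ⊥ : LSC (ContinuousValuation X)) = LSC.zero from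
      LSC.ext_fun fun μ => μ.map_bot', integral_zero]
  mono' U V h := ϖ.integral_mono fun μ => μ.mono h
  modular' U V := by
    rw [← integral_add, ← integral_add]
    congr 1
    exact LSC.ext_fun fun μ => μ.modular' U V
  map_sSup' S hS hd := by
    have : Nonempty S := hS.to_subtype
    rw [iSup_subtype']
    refine ϖ.integral_iSup_directed (fun U : S => eval U.1) (eval (sSup S)) ?_ ?_
    · intro i j
      obtain ⟨k, hk, hik, hjk⟩ := hd i i.2 j j.2
      exact ⟨⟨k, hk⟩, fun μ => μ.mono hik, fun μ => μ.mono hjk⟩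
    · intro μ
      refine (μ.map_sSup' S hS hd).trans ?_
      rw [iSup_subtype']
      rfl

theorem continuous_of_eval {f : Y → ContinuousValuation X}
    (h : ∀ U, LowerSemicontinuous fun y => f y U) : Continuous f := by
  refine continuous_generateFrom_iff.2 ?_
  rintro _ ⟨U, r, rfl⟩
  exact (h U).isOpen_preimage r

theorem continuous_dirac : Continuous (dirac : X → ContinuousValuation X) :=
  continuous_of_eval fun U => U.isOpen.lowerSemicontinuous_indicator zero_le_one

theorem continuous_map (f : C(X, Y)) : Continuous (map f) :=
  continuous_of_eval fun U => (eval (Opens.comap f U)).lsc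

theorem continuous_join : Continuous (join : _ → ContinuousValuation X) :=
  continuous_of_eval fun U => (evalIntegral (eval U)).lsc

theorem integral_map (f : C(X, Y)) (μ : ContinuousValuation X) (h : LSC Y) :
    (map f μ).integral h = μ.integral (h.comp f) := rfl

theorem integral_dirac (x : X) (h : LSC X) : (dirac x).integral h = h x := by
  rw [integral_eq_iSup]
  refine Eq.trans (iSup_congr fun N => ?_) (iSup_stepSum (h x))
  classical
  refine Finset.sum_congr rfl fun k _ => ?_
  simp only [dirac, indicator_apply, mul_ite, mul_one, mul_zero]
  exact if_congr Iff.rfl rfl rfl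

/-- The characteristic function of an open set integrates to its value. -/
theorem integral_indicator (μ : ContinuousValuation X) (U : Opens X) (h : LSC X)
    (hh : ∀ x, h x = indicator (U : Set X) (fun _ => 1) x) : μ.integral h = μ U := by
  have : h = LSC.zero.add (LSC.step 1 U) := LSC.ext_fun fun x => by
    rw [hh]
    exact (zero_add _).symm
  rw [this, integral_add_step, integral_zero]
  simp

theorem integral_join (ϖ : ContinuousValuation (ContinuousValuation X)) (h : LSC X) :
    (join ϖ).integral h = ϖ.integral (evalIntegral h) := by
  let c : ℕ → ℝ≥0 := fun N => (1 / 2) ^ N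
  let S : ℕ → ℕ → LSC (ContinuousValuation X) := fun N n =>
    n.rec LSC.zero fun k f => f.add ((eval (h.dyadicLevel N k)).smul (c N))
  have hS : ∀ N n μ, S N n μ = ∑ k ∈ Finset.range n, (c N : ℝ≥0∞) * μ (h.dyadicLevel N k) := by
    intro N n μ
    induction n with
    | zero => rfl
    | succ n ih => rw [Finset.sum_range_succ, ← ih]; rfl
  have hI : ∀ N n, ϖ.integral (S N n)
      = ∑ k ∈ Finset.range n, (c N : ℝ≥0∞) * join ϖ (h.dyadicLevel N k) := by
    intro N n
    induction n with
    | zero => exact ϖ.integral_zero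
    | succ n ih =>
      rw [Finset.sum_range_succ, ← ih]
      exact (ϖ.integral_add _ _).trans (congrArg _ (ϖ.integral_smul_half_pow N _))
  rw [ϖ.integral_iSup_nat (fun N => S N (4 ^ N)), integral_eq_iSup]
  · exact iSup_congr fun N => (hI N (4 ^ N)).symm
  · intro μ N M hNM
    simp only [hS]
    exact μ.dyadicSum_monotone h hNM
  · intro μ
    simp only [hS]
    exact μ.integral_eq_iSup h

end ContinuousValuation

section Monad

open CategoryTheory

/-- The category `TOP₀` of `T₀` topological spaces and continuous maps. -/
abbrev TopCat₀ : Type (u + 1) :=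
  ObjectProperty.FullSubcategory fun X : TopCat.{u} => T0Space X

/-- A `T₀` space as an object of `TOP₀`. -/
abbrev TopCat₀.of (X : Type u) [TopologicalSpace X] [T0Space X] : TopCat₀.{u} :=
  ⟨TopCat.of X, inferInstanceAs (T0Space X)⟩

/-- A continuous map as a morphism of `TOP₀`. -/
abbrev TopCat₀.ofHom {X Y : TopCat₀.{u}} (f : C(X.obj, Y.obj)) : X ⟶ Y :=
  ObjectProperty.homMk (TopCat.ofHom f)

/-- The endofunctor `V_w`. -/
noncomputable def valuationFunctor : TopCat₀.{u} ⥤ TopCat₀.{u} where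
  obj X := TopCat₀.of (ContinuousValuation X.obj)
  map f := TopCat₀.ofHom
    ⟨ContinuousValuation.map f.hom.hom, ContinuousValuation.continuous_map f.hom.hom⟩
  map_id _ := rfl
  map_comp _ _ := rfl

/-- The extended probabilistic powerdomain monad `V_w` on `TOP₀`. -/
noncomputable def valuationMonad : Monad TopCat₀.{u} where
  toFunctor := valuationFunctor
  η :=
    { app := fun X => TopCat₀.ofHom
        ⟨ContinuousValuation.dirac, ContinuousValuation.continuous_dirac⟩
      naturality := fun _ _ _ => rfl }
  μ :=
    { app := fun X => TopCat₀.ofHom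
        ⟨ContinuousValuation.join, ContinuousValuation.continuous_join⟩
      naturality := fun _ _ _ => rfl }
  assoc X := by
    apply ObjectProperty.hom_ext
    ext ξ
    refine ContinuousValuation.ext_apply fun U => ?_
    exact (ContinuousValuation.integral_join ξ (ContinuousValuation.eval U)).symm
  left_unit X := by
    apply ObjectProperty.hom_ext
    ext ν
    refine ContinuousValuation.ext_apply fun U => ?_
    exact ContinuousValuation.integral_dirac ν (ContinuousValuation.eval U)
  right_unit X := by
    apply ObjectProperty.hom_ext
    ext ν
    refine ContinuousValuation.ext_apply fun U => ?_
    exact ν.integral_indicator U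
      ((ContinuousValuation.eval U).comp
        ⟨ContinuousValuation.dirac, ContinuousValuation.continuous_dirac⟩) fun _ => rfl

end Monad

/-- A semitopological cone: a cone (that is, an `ℝ≥0`-module) with a `T₀` topology for which
addition and scalar multiplication are separately continuous, where the scalars carry the Scott
topology. -/
class SemitopologicalCone (C : Type u) [TopologicalSpace C] [AddCommMonoid C] [Module ℝ≥0 C] :
    Prop extends T0Space C where
  continuous_const_add : ∀ x : C, Continuous fun y : C => x + y
  continuous_add_const : ∀ y : C, Continuous fun x : C => x + y
  continuous_const_smul : ∀ r : ℝ≥0, Continuous fun x : C => r • x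
  continuous_smul_const : ∀ x : C,
    Continuous fun r : Topology.WithScott ℝ≥0 => Topology.WithScott.ofScott r • x

/-- A topological cone: a cone with a `T₀` topology for which addition and scalar multiplication
are jointly continuous, where the scalars carry the Scott topology. -/
class TopologicalCone (C : Type u) [TopologicalSpace C] [AddCommMonoid C] [Module ℝ≥0 C] :
    Prop extends T0Space C where
  continuous_add : Continuous fun p : C × C => p.1 + p.2
  continuous_smul :
    Continuous fun p : Topology.WithScott ℝ≥0 × C => Topology.WithScott.ofScott p.1 • p.2

/-- Weak local convexity: every open neighbourhood of a point contains a convex (not necessarily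
open) neighbourhood of that point. -/
def WeaklyLocallyConvex (C : Type u) [TopologicalSpace C] [AddCommMonoid C] [Module ℝ≥0 C] :
    Prop :=
  ∀ (x : C) (U : Set C), IsOpen U → x ∈ U → ∃ K ∈ nhds x, Convex ℝ≥0 K ∧ K ⊆ U

/-- A sober space: a `T₀` space in which every irreducible closed set has a generic point. -/
def IsSober (X : Type u) [TopologicalSpace X] : Prop := T0Space X ∧ QuasiSober X

/-- `b` is a barycentre of `ν`: for every lower semicontinuous linear `Λ : C → [0, ∞]`,
`Λ b = ∫ Λ dν`. -/
def IsBarycentre {C : Type u} [TopologicalSpace C] [AddCommMonoid C] [Module ℝ≥0 C]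
    (ν : ContinuousValuation C) (b : C) : Prop :=
  ∀ (Λ : C →ₗ[ℝ≥0] ℝ≥0∞) (hΛ : LowerSemicontinuous Λ), Λ b = ν.integral ⟨Λ, hΛ⟩

/-- `α` is the structure map of an Eilenberg-Moore algebra with carrier `X` of the monad `V_w`. -/
def IsValuationAlgebra {X : Type u} [TopologicalSpace X] [T0Space X]
    (α : C(ContinuousValuation X, X)) : Prop :=
  ∃ A : valuationMonad.{u}.Algebra, A.A = TopCat₀.of X ∧
    A.a ≍ (TopCat₀.ofHom α : TopCat₀.of (ContinuousValuation X) ⟶ TopCat₀.of X)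

/-- The addition induced by a structure map. -/
noncomputable def inducedAdd {X : Type u} [TopologicalSpace X]
    (α : C(ContinuousValuation X, X)) (x y : X) : X :=
  α (ContinuousValuation.dirac x + ContinuousValuation.dirac y)

/-- The scalar multiplication induced by a structure map. -/
noncomputable def inducedSMul {X : Type u} [TopologicalSpace X]
    (α : C(ContinuousValuation X, X)) (r : ℝ≥0) (x : X) : X :=
  α (r • ContinuousValuation.dirac x)

/-! Two principles carry the proof. The first is that barycentres are unique, so an identity `α ν =
b` holds as soon as `b` is shown to be a barycentre of `ν`. Linear maps `Λ` and the integral fit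
together for this: `x` is a barycentre of `δ_x`, and barycentres of sums and scalar multiples are
the sums and multiples of barycentres. This gives the unit law and the recovery of the cone
structure. It also makes `α` linear. For the associativity law, `IsBarycentre.map_of_join` rewrites
`∫ Λ d(join ϖ)` as the iterated integral `∫ (∫ Λ dν) dϖ(ν) = ∫ Λ(α ν) dϖ(ν)`, so the barycentre of
`join ϖ` is also that of the image of `ϖ` under `α`.

The second principle is that `α ∘ dirac = id` exhibits `C` as a retract of its space of valuations,
whose good properties descend. Sums and multiples of valuations are jointly continuous, and `x + y =
α (δ_x + δ_y)`, `r • x = α (r • δ_x)`. Weakly open sets contain convex open neighbourhoods of their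
points, and the linear map `α` sends these to convex neighbourhoods. For sobriety, an irreducible
closed set `S` defines a valuation `ofIrreducible` that dominates every `δ_x` with `x ∈ S` and lies
in the closure of these Dirac masses. Its image under `α` is therefore a generic point of `S`. -/

namespace ContinuousValuation

/-! ### Linear operations and specialization on valuations -/

variable {X : Type u} [TopologicalSpace X]

/-- Unlike additivity in the integrand, this is immediate from the Lebesgue integral: the level
function is antitone in `r`, hence measurable. -/
theorem integral_add_left (μ ν : ContinuousValuation X) (h : LSC X) :
    (μ + ν).integral h = μ.integral h + ν.integral h :=
  lintegral_add_left (μ.antitone_level h).measurable _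

theorem integral_smul_left (r : ℝ≥0) (μ : ContinuousValuation X) (h : LSC X) :
    (r • μ).integral h = r * μ.integral h :=
  lintegral_const_mul _ (μ.antitone_level h).measurable

/-- Pointwise larger valuations specialize to smaller ones. -/
theorem specializes_of_le {μ ν : ContinuousValuation X} (h : ∀ U, μ U ≤ ν U) : ν ⤳ μ := by
  -- It suffices that every weakly open set is upward closed for the pointwise order. Subbasic sets
  -- are, and the property passes to intersections and unions.
  rw [specializes_iff_forall_open]
  intro s hs hμ
  induction hs with
  | basic s hs =>
    obtain ⟨U, r, rfl⟩ := hs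
    exact lt_of_lt_of_le hμ (h U)
  | univ => trivial
  | inter s t _ _ ihs iht => exact ⟨ihs hμ.1, iht hμ.2⟩
  | sUnion S _ ih =>
    obtain ⟨s, hs, hμs⟩ := hμ
    exact ⟨s, hs, ih s hs hμs⟩

/-- Joint continuity is automatic here: the weak topology only tests values at a single `U`, and
sums of lower semicontinuous functions are lower semicontinuous. -/
theorem continuous_add_prod :
    Continuous fun p : ContinuousValuation X × ContinuousValuation X => p.1 + p.2 :=
  continuous_of_eval fun U =>
    ((eval U).lsc.comp continuous_fst).add ((eval U).lsc.comp continuous_snd)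

end ContinuousValuation

/-! ### Scott topology on the scalars and joint continuity of scaling -/

theorem isOpen_withScott_Ioi (c : ℝ≥0) :
    IsOpen {r : Topology.WithScott ℝ≥0 | c < Topology.WithScott.ofScott r} := by
  rw [Topology.IsScott.isOpen_iff_isUpperSet_and_dirSupInaccOn (D := univ)]
  refine ⟨fun a b hab ha => lt_of_lt_of_le ha hab, ?_⟩
  intro d _ _ _ a had ha
  by_contra hcon
  -- If no member of `d` exceeds `c`, then `c` bounds `d` from above, and so it bounds the supremum
  -- `a`.
  have hle : a ≤ Topology.WithScott.toScott c := had.2 fun b hb => by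
    by_contra hb'
    exact hcon ⟨b, hb, lt_of_not_ge (α := ℝ≥0) hb'⟩
  exact not_le_of_gt (α := ℝ≥0) ha hle

theorem lowerSemicontinuous_ofScott :
    LowerSemicontinuous fun r : Topology.WithScott ℝ≥0 =>
      ((Topology.WithScott.ofScott r : ℝ≥0) : ℝ≥0∞) := by
  rw [lowerSemicontinuous_iff_isOpen_preimage]
  intro c
  induction c with
  | top => simp
  | coe c => simpa [preimage, mem_Ioi] using isOpen_withScott_Ioi c

/-- Multiplication on `[0, ∞]` is not continuous at `(0, ∞)`, but a product is still the supremum of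
the products of strictly smaller factors, which is all that lower semicontinuity needs. -/
theorem LowerSemicontinuous.ennreal_mul {Z : Type*} [TopologicalSpace Z] {f g : Z → ℝ≥0∞}
    (hf : LowerSemicontinuous f) (hg : LowerSemicontinuous g) :
    LowerSemicontinuous fun z => f z * g z := by
  intro z t ht
  obtain ⟨a, ha, b, hb, hab⟩ : ∃ a < f z, ∃ b < g z, t < a * b := by
    by_contra! hcon
    exact absurd ht (not_lt.2 (ENNReal.mul_le_of_forall_lt hcon))
  filter_upwards [hf z a ha, hg z b hb] with w h1 h2
  exact lt_of_lt_of_le hab (mul_le_mul' h1.le h2.le)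

namespace ContinuousValuation

variable {X : Type u} [TopologicalSpace X]

theorem continuous_smul_prod :
    Continuous fun p : Topology.WithScott ℝ≥0 × ContinuousValuation X =>
      Topology.WithScott.ofScott p.1 • p.2 :=
  continuous_of_eval fun U =>
    (lowerSemicontinuous_ofScott.comp continuous_fst).ennreal_mul
      ((eval U).lsc.comp continuous_snd)

/-! ### Irreducible sets as valuations, convex neighbourhoods and sobriety -/

open Classical in
/-- The valuation that gives mass `1` to the open sets that meet a given irreducible set. -/
noncomputable def ofIrreducible {S : Set X} (hS : IsIrreducible S) : ContinuousValuation X where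
  toFun U := if (S ∩ U).Nonempty then 1 else 0
  map_bot' := by simp
  mono' U V h := by
    split_ifs with h1 h2
    · exact le_rfl
    · exact absurd (h1.mono (inter_subset_inter_right S h)) h2
    all_goals exact zero_le
  modular' U V := by
    have hsup : (S ∩ (U ⊔ V : Opens X)).Nonempty ↔ (S ∩ U).Nonempty ∨ (S ∩ V).Nonempty := by
      rw [Opens.coe_sup, inter_union_distrib_left, union_nonempty]
    -- Irreducibility enters here: two open sets that meet `S` have an intersection that meets `S`.
    have hinf : (S ∩ (U ⊓ V : Opens X)).Nonempty ↔ (S ∩ U).Nonempty ∧ (S ∩ V).Nonempty :=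
      ⟨fun h => ⟨h.mono (inter_subset_inter_right S inter_subset_left),
        h.mono (inter_subset_inter_right S inter_subset_right)⟩,
        fun h => hS.2 U V U.isOpen V.isOpen h.1 h.2⟩
    simp only [hsup, hinf]
    by_cases hU : (S ∩ U).Nonempty <;> by_cases hV : (S ∩ V).Nonempty <;> simp [hU, hV]
  map_sSup' T _ _ := by
    refine le_antisymm ?_ (iSup₂_le fun U hU => ?_)
    · split_ifs with h
      · obtain ⟨x, hxS, hx⟩ := h
        obtain ⟨U, hU, hxU⟩ := Opens.mem_sSup.1 hx
        exact le_iSup₂_of_le U hU (by rw [if_pos ⟨x, hxS, hxU⟩])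
      · exact zero_le
    · split_ifs with h1 h2
      · exact le_rfl
      · exact absurd (h1.mono (inter_subset_inter_right S fun x hx => Opens.mem_sSup.2 ⟨U, hU, hx⟩)) h2
      all_goals exact zero_le

/-- An open set containing a point of `S` meets `S`. By `specializes_of_le`, this makes
`ofIrreducible hS` specialize to each such Dirac mass. -/
theorem dirac_le_ofIrreducible {S : Set X} (hS : IsIrreducible S) {x : X} (hx : x ∈ S)
    (U : Opens X) : dirac x U ≤ ofIrreducible hS U := by
  classical
  change indicator (U : Set X) (fun _ => (1 : ℝ≥0∞)) x ≤ _
  refine indicator_apply_le' (fun hU => ?_) fun _ => zero_le (a := ofIrreducible hS U)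
  exact (if_pos (⟨x, hx, hU⟩ : (S ∩ U).Nonempty)).ge

/-- `ofIrreducible hS` lies in the closure of the Dirac masses at points of `S`. -/
theorem exists_dirac_mem {S : Set X} (hS : IsIrreducible S) {W : Set (ContinuousValuation X)}
    (hW : IsOpen W) (h : ofIrreducible hS ∈ W) : ∃ x ∈ S, dirac x ∈ W := by
  -- A single witness `x` would not survive intersections. A whole open set of witnesses does,
  -- because irreducibility lets two such sets meet inside `S`.
  suffices H : ∃ U : Opens X, (S ∩ U).Nonempty ∧ ∀ x ∈ U, dirac x ∈ W by
    obtain ⟨U, ⟨x, hxS, hxU⟩, hU⟩ := H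
    exact ⟨x, hxS, hU x hxU⟩
  induction hW with
  | basic s hs =>
    obtain ⟨U, r, rfl⟩ := hs
    have h' : (r : ℝ≥0∞) < ofIrreducible hS U := h
    have hne : (S ∩ U).Nonempty := by
      by_contra hne
      rw [show ofIrreducible hS U = 0 from if_neg hne] at h'
      exact not_lt_zero h'
    refine ⟨U, hne, fun x hx => ?_⟩
    rw [show ofIrreducible hS U = 1 from if_pos hne] at h'
    have hd : dirac x U = 1 :=
      indicator_of_mem (show x ∈ (U : Set X) from hx) fun _ => (1 : ℝ≥0∞)
    exact (hd ▸ h' : (r : ℝ≥0∞) < dirac x U)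
  | univ => exact ⟨⊤, by simpa using hS.1, fun _ _ => trivial⟩
  | inter s t _ _ ihs iht =>
    obtain ⟨U, hU, hUs⟩ := ihs h.1
    obtain ⟨V, hV, hVt⟩ := iht h.2
    exact ⟨U ⊓ V, hS.2 U V U.isOpen V.isOpen hU hV, fun x hx => ⟨hUs x hx.1, hVt x hx.2⟩⟩
  | sUnion T _ ih =>
    obtain ⟨s, hs, hμ⟩ := h
    obtain ⟨U, hU, hUs⟩ := ih s hs hμ
    exact ⟨U, hU, fun x hx => ⟨s, hs, hUs x hx⟩⟩

/-- The weak topology has a neighbourhood basis of open sets that are closed under convex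
combinations. -/
theorem exists_convex_open_subset {W : Set (ContinuousValuation X)} (hW : IsOpen W)
    {μ : ContinuousValuation X} (h : μ ∈ W) :
    ∃ K ⊆ W, IsOpen K ∧ μ ∈ K ∧
      ∀ ν ∈ K, ∀ ρ ∈ K, ∀ a b : ℝ≥0, a + b = 1 → a • ν + b • ρ ∈ K := by
  -- A union of convex sets need not be convex, so the induction produces a convex `K` inside `W`
  -- and around `μ`; for a union, the member containing `μ` supplies it.
  induction hW with
  | basic s hs =>
    obtain ⟨U, r, rfl⟩ := hs
    refine ⟨_, subset_rfl, isOpen_setOf_lt U r, h, fun ν hν ρ hρ a b hab => ?_⟩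
    change (r : ℝ≥0∞) < a * ν U + b * ρ U
    -- Comparing with the minimum keeps the inequality strict even when one of the coefficients is
    -- zero.
    have hm : (r : ℝ≥0∞) < min (ν U) (ρ U) := lt_min hν hρ
    refine lt_of_lt_of_le hm ?_
    calc min (ν U) (ρ U) = (a + b) * min (ν U) (ρ U) := by
          rw [← ENNReal.coe_add, hab, ENNReal.coe_one, one_mul]
      _ = a * min (ν U) (ρ U) + b * min (ν U) (ρ U) := add_mul _ _ _
      _ ≤ a * ν U + b * ρ U := by
          gcongr
          · exact min_le_left _ _
          · exact min_le_right _ _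
  | univ => exact ⟨univ, subset_rfl, isOpen_univ, trivial, fun _ _ _ _ _ _ _ => trivial⟩
  | inter s t _ _ ihs iht =>
    obtain ⟨K, hKs, hK, hμK, hKc⟩ := ihs h.1
    obtain ⟨L, hLt, hL, hμL, hLc⟩ := iht h.2
    exact ⟨K ∩ L, inter_subset_inter hKs hLt, hK.inter hL, ⟨hμK, hμL⟩,
      fun ν hν ρ hρ a b hab =>
        ⟨hKc ν hν.1 ρ hρ.1 a b hab, hLc ν hν.2 ρ hρ.2 a b hab⟩⟩
  | sUnion T _ ih =>
    obtain ⟨s, hs, hμ⟩ := h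
    obtain ⟨K, hKs, hK⟩ := ih s hs hμ
    exact ⟨K, hKs.trans (subset_sUnion_of_mem hs), hK⟩

/-- A continuous retraction of `dirac` makes the space quasi-sober. -/
theorem quasiSober_of_retraction (α : C(ContinuousValuation X, X))
    (hα : ∀ x, α (dirac x) = x) : QuasiSober X where
  sober {S} hS hcl := by
    refine ⟨α (ofIrreducible hS), subset_antisymm ?_ fun x hx => ?_⟩
    · refine closure_minimal (singleton_subset_iff.2 ?_) hcl
      by_contra hb
      -- If `α (ofIrreducible hS)` lay in the open complement of `S`, so would `α (dirac x) = x` for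
      -- some `x ∈ S`.
      obtain ⟨x, hxS, hx⟩ := exists_dirac_mem hS (hcl.isOpen_compl.preimage α.continuous) hb
      rw [mem_preimage, hα] at hx
      exact hx hxS
    -- Continuous maps preserve specialization, so `α (ofIrreducible hS)` specializes to `α (dirac
    -- x) = x`.
    · rw [← specializes_iff_mem_closure, ← hα x]
      exact (specializes_of_le (dirac_le_ofIrreducible hS hx)).map α.continuous

end ContinuousValuation

/-! ### Calculus of barycentres -/

namespace IsBarycentre

variable {C : Type u} [TopologicalSpace C] [AddCommMonoid C] [Module ℝ≥0 C]

theorem dirac (x : C) : IsBarycentre (ContinuousValuation.dirac x) x := fun Λ hΛ =>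
  (ContinuousValuation.integral_dirac x ⟨Λ, hΛ⟩).symm

/-- Together with `smul` and uniqueness of barycentres, this makes any barycentre map linear. -/
theorem add {μ ν : ContinuousValuation C} {b c : C} (hb : IsBarycentre μ b)
    (hc : IsBarycentre ν c) : IsBarycentre (μ + ν) (b + c) := fun Λ hΛ => by
  rw [map_add, ContinuousValuation.integral_add_left, hb Λ hΛ, hc Λ hΛ]

theorem smul {μ : ContinuousValuation C} {b : C} (r : ℝ≥0) (hb : IsBarycentre μ b) :
    IsBarycentre (r • μ) (r • b) := fun Λ hΛ => by
  rw [map_smul, ContinuousValuation.integral_smul_left, hb Λ hΛ]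
  rfl

/-- A barycentre of `join ϖ` is a barycentre of the image of `ϖ` under a barycentre map. -/
theorem map_of_join {α : C(ContinuousValuation C, C)} (hα : ∀ ν, IsBarycentre ν (α ν))
    {ϖ : ContinuousValuation (ContinuousValuation C)} {b : C}
    (hb : IsBarycentre ϖ.join b) : IsBarycentre (ϖ.map α) b := fun Λ hΛ => by
  rw [hb Λ hΛ, ContinuousValuation.integral_join, ContinuousValuation.integral_map]
  -- Both sides integrate against `ϖ`; the integrands `ν ↦ ∫ Λ dν` and `Λ ∘ α` agree because `α ν`
  -- is a barycentre of `ν`.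
  congr 1
  exact LSC.ext_fun fun ν => (hα ν Λ hΛ).symm

end IsBarycentre

/-! ### Algebra laws and the main theorem -/

/-- The algebra laws, stated for points. -/
theorem isValuationAlgebra_of_forall {X : Type u} [TopologicalSpace X] [T0Space X]
    (α : C(ContinuousValuation X, X)) (hunit : ∀ x, α (ContinuousValuation.dirac x) = x)
    (hassoc : ∀ ϖ : ContinuousValuation (ContinuousValuation X),
      α ϖ.join = α (ϖ.map α)) : IsValuationAlgebra α := by
  refine ⟨{ A := TopCat₀.of X, a := TopCat₀.ofHom α, unit := ?_, assoc := ?_ }, rfl, HEq.rfl⟩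
  · apply CategoryTheory.ObjectProperty.hom_ext
    ext x
    exact hunit x
  · apply CategoryTheory.ObjectProperty.hom_ext
    ext ϖ
    exact hassoc ϖ

theorem mainTheorem3 (C : Type u) [TopologicalSpace C] [AddCommMonoid C] [Module ℝ≥0 C]
    [SemitopologicalCone C] (α : C(ContinuousValuation C, C))
    (hα : ∀ ν : ContinuousValuation C,
      IsBarycentre ν (α ν) ∧ ∀ b : C, IsBarycentre ν b → b = α ν) :
    IsValuationAlgebra α ∧
    (∀ x y : C, inducedAdd α x y = x + y) ∧
    (∀ (r : ℝ≥0) (x : C), inducedSMul α r x = r • x) ∧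
    IsSober C ∧ WeaklyLocallyConvex C ∧ TopologicalCone C := by
  have hbar : ∀ ν, IsBarycentre ν (α ν) := fun ν => (hα ν).1
  have huniq : ∀ {ν b}, IsBarycentre ν b → α ν = b := fun h => ((hα _).2 _ h).symm
  have hdirac : ∀ x, α (ContinuousValuation.dirac x) = x := fun x => huniq (.dirac x)
  have hadd : ∀ x y : C, inducedAdd α x y = x + y := fun x y =>
    huniq ((IsBarycentre.dirac x).add (.dirac y))
  have hsmul : ∀ (r : ℝ≥0) (x : C), inducedSMul α r x = r • x := fun r x =>
    huniq ((IsBarycentre.dirac x).smul r)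
  refine ⟨isValuationAlgebra_of_forall α hdirac fun ϖ => ?_, hadd, hsmul,
    ⟨inferInstance, ContinuousValuation.quasiSober_of_retraction α hdirac⟩, ?_, ?_⟩
  -- The point `α ϖ.join` is a barycentre of `ϖ.map α`, so uniqueness identifies it with `α (ϖ.map
  -- α)`.
  · exact (huniq (.map_of_join hbar (hbar ϖ.join))).symm
  · intro x U hU hx
    obtain ⟨K, hKU, hK, hxK, hKc⟩ := ContinuousValuation.exists_convex_open_subset
      (hU.preimage α.continuous) (μ := ContinuousValuation.dirac x)
      (show α _ ∈ U from (hdirac x).symm ▸ hx)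
    -- The set `α '' K` need not be open, but it contains the open set `dirac ⁻¹' K` because `α
    -- (dirac y) = y`; this is why the convexity obtained is only weak.
    refine ⟨α '' K, ?_, ?_, image_subset_iff.2 hKU⟩
    · filter_upwards [(hK.preimage ContinuousValuation.continuous_dirac).mem_nhds hxK] with y hy
      exact ⟨_, hy, hdirac y⟩
    · rintro _ ⟨ν, hν, rfl⟩ _ ⟨ρ, hρ, rfl⟩ a b _ _ hab
      -- Uniqueness gives `α (a • ν + b • ρ) = a • α ν + b • α ρ`, so convexity of `K` passes to its
      -- image.
      exact ⟨_, hKc ν hν ρ hρ a b hab, huniq (((hbar ν).smul a).add ((hbar ρ).smul b))⟩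
  · refine { continuous_add := ?_, continuous_smul := ?_ }
    -- Rewriting `x + y` as `α (δ_x + δ_y)` factors addition through the jointly continuous addition
    -- of valuations; scaling is treated the same way.
    · simp_rw [← hadd]
      exact α.continuous.comp (ContinuousValuation.continuous_add_prod.comp
        (ContinuousValuation.continuous_dirac.prodMap ContinuousValuation.continuous_dirac))
    · simp_rw [← hsmul]
      exact α.continuous.comp (ContinuousValuation.continuous_smul_prod.comp
        (continuous_id.prodMap ContinuousValuation.continuous_dirac))
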